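/- Let $d\ge 1$ be an integer. For $j\in\mathbb Z$, $m\in\mathbb Z^d$ let $Q_{j,m}=2^{-j}(m+[0,1)^d)\subset\mathbb R^d$. For $0<p\le u<\infty$ and $j\in\mathbb N_0$ put $\mathcal K_j=\{k\in\mathbb Z^d: Q_{0,k}\subset Q_{-j,0}\}$, and let $m^{2^{jd}}_{u,p}$ be the space of all complex families $\lambda=\{\lambda_k\}_{k\in\mathcal K_j}$ with the quasi-norm $$\|\lambda\,|\,m^{2^{jd}}_{u,p}\|=\sup_{Q_{-\nu,m}\subset Q_{-j,0}}|Q_{-\nu,m}|^{\frac1u-\frac1p}\Big(\sum_{k:\,Q_{0,k}\subset Q_{-\nu,m}}|\lambda_k|^p\Big)^{1/p},$$ the supremum being taken over all $\nu\in\mathbb N_0$, $m\in\mathbb Z^d$ with $Q_{-\nu,m}\subset Q_{-j,0}$. For $k\in\mathbb N=\{1,2,\dots\}$ the $k$-th (dyadic) entropy number $e_k(T)$ of a linear map $T:X\to Y$ between complex quasi-normed spaces is the infimum of all $\varepsilon>0$ such that $T(\{x\in X:\|x\|_X\le 1\})$ is covered by $2^{k-1}$ balls of radius $\varepsilon$ in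 $Y$. Let $0<p_i\le u_i<\infty$, $i=1,2$, and let $c>0$. Then there are constants $A,B>0$, depending only on $d,u_1,p_1,u_2,p_2$ and $c$, such that for all $j\in\mathbb N_0$ and all $k\in\mathbb N_0$ with $k\ge c\,2^{jd}$ the identity $\mathrm{id}_j:m^{2^{jd}}_{u_1,p_1}\to m^{2^{jd}}_{u_2,p_2}$ satisfies $$A\,2^{-\frac{k}{2\cdot 2^{jd}}}\,2^{jd\left(\frac1{u_2}-\frac1{u_1}\right)}\le e_k(\mathrm{id}_j)\le B\,2^{-\frac{k}{2\cdot 2^{jd}}}\,2^{jd\left(\frac1{u_2}-\frac1{u_1}\right)}.$$ -/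

import Mathlib

open MeasureTheory

noncomputable section

namespace MorreySeq

/-- The dyadic cube `Q_{j,m} = 2^{-j} (m + [0,1)^d)` in `ℝ^d`, for `j ∈ ℤ` and `m ∈ ℤ^d`. -/
def dyadicCube {d : ℕ} (j : ℤ) (m : Fin d → ℤ) : Set (Fin d → ℝ) :=
  {x | ∀ i, (2 : ℝ) ^ (-j) * (m i : ℝ) ≤ x i ∧ x i < (2 : ℝ) ^ (-j) * ((m i : ℝ) + 1)}

/-- The index set `K_j = {k ∈ ℤ^d : Q_{0,k} ⊆ Q_{-j,0}}`. -/
def indexSet (d j : ℕ) : Set (Fin d → ℤ) :=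
  {k | dyadicCube 0 k ⊆ dyadicCube (-(j : ℤ)) 0}

theorem indexSet_finite (d j : ℕ) : (indexSet d j).Finite := by
  refine (Set.finite_Icc (0 : Fin d → ℤ) (fun _ => 2 ^ j)).subset fun k hk => ?_
  have hx : (fun i => (k i : ℝ)) ∈ dyadicCube 0 k := fun i => by simp
  have h := hk hx
  refine ⟨fun i => ?_, fun i => ?_⟩
  · have := (h i).1
    simp only [Pi.zero_apply, Int.cast_zero, mul_zero] at this
    exact_mod_cast this
  · have := (h i).2.le
    simp only [Pi.zero_apply, Int.cast_zero, zero_add, mul_one, neg_neg, zpow_natCast] at this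
    exact_mod_cast this

instance (d j : ℕ) : Fintype (indexSet d j) := (indexSet_finite d j).fintype

/-- The vector space underlying `m_{u,p}^{2^{jd}}`: the complex families indexed by `K_j`.
It carries the quasi-norm defined below. -/
def Space (d j : ℕ) (_u _p : ℝ) : Type := indexSet d j → ℂ

instance (d j : ℕ) (u p : ℝ) : AddCommGroup (Space d j u p) :=
  inferInstanceAs (AddCommGroup (indexSet d j → ℂ))

instance (d j : ℕ) (u p : ℝ) : Module ℂ (Space d j u p) :=
  inferInstanceAs (Module ℂ (indexSet d j → ℂ))

/-- The pairs `(ν, m)`, `ν ∈ ℕ₀`, `m ∈ ℤ^d`, with `Q_{-ν,m} ⊆ Q_{-j,0}`. -/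
def SubCube (d j : ℕ) : Type :=
  {q : ℕ × (Fin d → ℤ) // dyadicCube (-(q.1 : ℤ)) q.2 ⊆ dyadicCube (-(j : ℤ)) 0}

/-- The cube `Q_{-ν,m}`. -/
def SubCube.cube {d j : ℕ} (q : SubCube d j) : Set (Fin d → ℝ) :=
  dyadicCube (-(q.1.1 : ℤ)) q.1.2

open Classical in
/-- The contribution of one cube,
`|Q|^{1/u - 1/p} (∑_{k : Q_{0,k} ⊆ Q} |λ_k|^p)^{1/p}`, to the quasi-norm. -/
def cubeTerm {d j : ℕ} (u p : ℝ) (lam : Space d j u p) (q : SubCube d j) : ℝ :=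
  (volume q.cube).toReal ^ (1 / u - 1 / p) *
    (∑ k : indexSet d j with dyadicCube 0 k.1 ⊆ q.cube, ‖(lam k : ℂ)‖ ^ p) ^ (1 / p)

/-- `‖λ | m_{u,p}^{2^{jd}}‖ = sup_{Q_{-ν,m} ⊆ Q_{-j,0}}
|Q_{-ν,m}|^{1/u - 1/p} (∑_{k : Q_{0,k} ⊆ Q_{-ν,m}} |λ_k|^p)^{1/p}`. -/
instance (d j : ℕ) (u p : ℝ) : Norm (Space d j u p) :=
  ⟨fun lam => ⨆ q : SubCube d j, cubeTerm u p lam q⟩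

theorem volume_dyadicCube {d : ℕ} (ν : ℕ) (m : Fin d → ℤ) :
    (volume (dyadicCube (-(ν : ℤ)) m)).toReal = 2 ^ (ν * d) := by
  have h : dyadicCube (-(ν : ℤ)) m = Set.pi Set.univ fun i =>
      Set.Ico ((2 : ℝ) ^ ν * (m i : ℝ)) ((2 : ℝ) ^ ν * ((m i : ℝ) + 1)) := by
    ext x
    simp [dyadicCube, Set.mem_pi]
  rw [h, Real.volume_pi_Ico_toReal]
  · have : ∀ i : Fin d, (2 : ℝ) ^ ν * ((m i : ℝ) + 1) - (2 : ℝ) ^ ν * (m i : ℝ) = 2 ^ ν :=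
      fun i => by ring
    simp [this, pow_mul]
  · intro i
    exact mul_le_mul_of_nonneg_left (by linarith) (by positivity)

/-- The supremum in the quasi-norm is a supremum of a set that is bounded above. -/
theorem bddAbove_cubeTerm {d j : ℕ} {u p : ℝ} (hp : 0 < p) (hpu : p ≤ u)
    (lam : Space d j u p) : BddAbove (Set.range (cubeTerm u p lam)) := by
  classical
  refine ⟨(∑ k : indexSet d j, ‖(lam k : ℂ)‖ ^ p) ^ (1 / p), ?_⟩
  rintro _ ⟨q, rfl⟩
  have h1 : (volume q.cube).toReal ^ (1 / u - 1 / p) ≤ 1 := by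
    refine Real.rpow_le_one_of_one_le_of_nonpos ?_ ?_
    · rw [SubCube.cube, volume_dyadicCube]
      exact one_le_pow₀ (by norm_num)
    · have := one_div_le_one_div_of_le hp hpu
      linarith
  have h2 : (∑ k : indexSet d j with dyadicCube 0 k.1 ⊆ q.cube, ‖(lam k : ℂ)‖ ^ p) ^ (1 / p) ≤
      (∑ k : indexSet d j, ‖(lam k : ℂ)‖ ^ p) ^ (1 / p) := by
    refine Real.rpow_le_rpow (Finset.sum_nonneg fun k _ => by positivity) ?_ (by positivity)
    exact Finset.sum_le_sum_of_subset_of_nonneg (Finset.filter_subset _ _)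
      fun k _ _ => by positivity
  have h3 : 0 ≤ (∑ k : indexSet d j with dyadicCube 0 k.1 ⊆ q.cube,
      ‖(lam k : ℂ)‖ ^ p) ^ (1 / p) :=
    Real.rpow_nonneg (Finset.sum_nonneg fun k _ => by positivity) _
  unfold cubeTerm
  refine (mul_le_of_le_one_left ?_ h1).trans ?_
  · convert h3
  · convert h2

/-- The identity map `id_j : m_{u₁,p₁}^{2^{jd}} → m_{u₂,p₂}^{2^{jd}}`. -/
def idMap (d j : ℕ) (u₁ p₁ u₂ p₂ : ℝ) : Space d j u₁ p₁ →ₗ[ℂ] Space d j u₂ p₂ where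
  toFun lam := lam
  map_add' _ _ := rfl
  map_smul' _ _ := rfl

/-- The `k`-th dyadic entropy number (`k ≥ 1`) of a linear map `T` between complex quasi-normed
spaces: the infimum of all `ε > 0` such that `2^{k-1}` balls of radius `ε` cover the image of the
closed unit ball. -/
def entropyNumber {X Y : Type*} [AddCommGroup X] [Module ℂ X] [Norm X]
    [AddCommGroup Y] [Module ℂ Y] [Norm Y] (k : ℕ) (T : X →ₗ[ℂ] Y) : ℝ :=
  sInf {ε : ℝ | 0 < ε ∧ ∃ y : Fin (2 ^ (k - 1)) → Y,
    ∀ x : X, ‖x‖ ≤ 1 → ∃ i, ‖T x - y i‖ ≤ ε}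

end MorreySeq

end

/-! Write `V = 2^{jd}`. The argument is a volume comparison in real dimension `2V`, which is why `k`
is divided by `2V`. The largest cube shows that the Morrey unit ball lies in the set where the
`p`-mean of the moduli is at most `V^{-1/u}` (`sum_rpow_le_of_norm_le`). Conversely, moduli at most
`s` give a norm at most `V^{1/u} s` (`norm_le_of_forall_le`). Up to a constant per coordinate the
ball thus has size `V^{-1/u}`, whatever `p` is.

Volumes are replaced by counts of integer points with bounded `p`-mean
(`exists_card_le_of_sum_rpow_le`). For the upper bound, unit-ball coordinates are truncated to a
grid with at most `2^{k-1}` relevant points (`exists_cover_of_card_le`, with parameters from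
`exists_grid_parameters`). For the lower bound, an `ε`-ball holds at most `D^{2V}` points of a grid
of width about `ε V^{-1/u₂}` (`exists_card_grid_le`), so `2^{k-1}` balls cannot cover a large grid
cube inside the unit ball (`exists_le_of_cover`). -/

open MeasureTheory

noncomputable section

namespace MorreySeq

/-! ### Integer points with bounded `p`-mean. -/

section Counting

/-- The exponential `exp (-x ^ p)` decays faster than `(1 + x)⁻²`. -/
theorem exists_exp_neg_rpow_le {p : ℝ} (hp : 0 < p) :
    ∃ C : ℝ, 0 < C ∧ ∀ x : ℝ, 0 ≤ x → Real.exp (-x ^ p) ≤ C / (1 + x) ^ 2 := by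
  -- With `p * M ≥ 2`, the `M`-th term of the exponential series of `x ^ p` dominates `x ^ 2` for `x
  -- ≥ 1`.
  obtain ⟨M, hM⟩ := exists_nat_ge (2 / p)
  have hMp : 2 ≤ p * M := by
    rw [div_le_iff₀ hp] at hM
    linarith
  refine ⟨4 * (1 + M.factorial), by positivity, fun x hx => ?_⟩
  rw [le_div_iff₀ (by positivity)]
  have hxp : 0 ≤ x ^ p := Real.rpow_nonneg hx p
  have h1 : Real.exp (-x ^ p) ≤ 1 := Real.exp_le_one_iff.2 (by linarith)
  have h2 : (x ^ p) ^ M * Real.exp (-x ^ p) ≤ M.factorial := by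
    have := Real.pow_div_factorial_le_exp (x ^ p) hxp M
    rw [div_le_iff₀ (by positivity)] at this
    rw [Real.exp_neg, ← div_eq_mul_inv, div_le_iff₀ (Real.exp_pos _)]
    linarith
  have h3 : (1 + x) ^ 2 ≤ 4 * (1 + (x ^ p) ^ M) := by
    rcases le_total x 1 with h | h
    · have : 0 ≤ (x ^ p) ^ M := by positivity
      nlinarith
    · have : x ^ 2 ≤ (x ^ p) ^ M := by
        rw [← Real.rpow_natCast (x ^ p), ← Real.rpow_mul hx, ← Real.rpow_natCast x 2]
        exact Real.rpow_le_rpow_of_exponent_le h (by exact_mod_cast hMp)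
      nlinarith
  calc Real.exp (-x ^ p) * (1 + x) ^ 2 ≤ Real.exp (-x ^ p) * (4 * (1 + (x ^ p) ^ M)) := by gcongr
    _ = 4 * (Real.exp (-x ^ p) + (x ^ p) ^ M * Real.exp (-x ^ p)) := by ring
    _ ≤ _ := by gcongr

/-- Telescoping: one factor of each squared denominator is replaced by its predecessor. -/
theorem sum_range_inv_one_add_mul_sq_le {h : ℝ} (hh : 0 < h) (M : ℕ) :
    ∑ n ∈ Finset.range M, 1 / (1 + h * (n + 1 : ℝ)) ^ 2 ≤ 1 / h - 1 / (h * (1 + h * M)) := by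
  induction M with
  | zero => simp
  | succ M ih =>
    rw [Finset.sum_range_succ]
    have key : 1 / (1 + h * (M + 1 : ℝ)) ^ 2 ≤
        1 / (h * (1 + h * M)) - 1 / (h * (1 + h * (M + 1 : ℝ))) := by
      have e : 1 / (h * (1 + h * M)) - 1 / (h * (1 + h * (M + 1 : ℝ))) =
          1 / ((1 + h * M) * (1 + h * (M + 1 : ℝ))) := by
        field_simp
        ring
      rw [e]
      refine one_div_le_one_div_of_le (by positivity) ?_
      rw [sq]
      gcongr
      linarith
    push_cast
    linarith

/-- The `1` is the term `a = 0`. The bound is uniform in the cutoff `M`, and it tends to `1` as `h`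
grows, which is needed when few points are allowed. -/
theorem exists_sum_exp_neg_le {p : ℝ} (hp : 0 < p) :
    ∃ C : ℝ, 0 < C ∧ ∀ (h : ℝ) (M : ℕ), 0 < h →
      ∑ a ∈ Finset.Icc (-M : ℤ) M, Real.exp (-(h * |(a : ℝ)|) ^ p) ≤ 1 + C / h := by
  obtain ⟨C, hC, hexp⟩ := exists_exp_neg_rpow_le hp
  refine ⟨2 * C, by positivity, fun h M hh => ?_⟩
  have hpart : ∑ n ∈ Finset.range M, Real.exp (-(h * (n + 1 : ℝ)) ^ p) ≤ C / h := by
    calc _ ≤ ∑ n ∈ Finset.range M, C * (1 / (1 + h * (n + 1 : ℝ)) ^ 2) := by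
          refine Finset.sum_le_sum fun n _ => ?_
          rw [mul_one_div]
          exact hexp _ (by positivity)
      _ = C * ∑ n ∈ Finset.range M, 1 / (1 + h * (n + 1 : ℝ)) ^ 2 := by rw [Finset.mul_sum]
      _ ≤ C * (1 / h) := by
          gcongr
          have := sum_range_inv_one_add_mul_sq_le hh M
          have : 0 ≤ 1 / (h * (1 + h * M)) := by positivity
          linarith
      _ = C / h := by ring
  have hsum : ∑ a ∈ Finset.Icc (-M : ℤ) M, Real.exp (-(h * |(a : ℝ)|) ^ p) =
      1 + 2 * ∑ n ∈ Finset.range M, Real.exp (-(h * (n + 1 : ℝ)) ^ p) := by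
    clear hpart
    induction M with
    | zero => simp [Real.zero_rpow hp.ne']
    | succ M ih =>
      have e : Finset.Icc (-(M + 1 : ℕ) : ℤ) (M + 1 : ℕ) =
          insert (-(M + 1 : ℤ)) (insert (M + 1 : ℤ) (Finset.Icc (-M : ℤ) M)) := by
        ext a
        simp only [Finset.mem_Icc, Finset.mem_insert]
        push_cast
        omega
      rw [e, Finset.sum_insert, Finset.sum_insert, ih, Finset.sum_range_succ]
      · have h0 : |((M : ℝ) + 1)| = M + 1 := abs_of_nonneg (by positivity)
        push_cast
        rw [abs_neg, h0]
        ring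
      · simp
      · simp only [Finset.mem_Icc, Finset.mem_insert]
        omega
  rw [hsum]
  have : 2 * C / h = 2 * (C / h) := by ring
  linarith

/-- Bound for the number of integer points in a ball of `ℓ_p`. -/
theorem exists_card_le_of_sum_rpow_le {p : ℝ} (hp : 0 < p) :
    ∃ C : ℝ, 0 < C ∧ ∀ (ι : Type) [Fintype ι] (F : Finset (ι → ℤ)) (t h : ℝ), 0 ≤ t → 0 < h →
      (∀ n ∈ F, ∑ i, |(n i : ℝ)| ^ p ≤ Fintype.card ι * t ^ p) →
      (F.card : ℝ) ≤ (Real.exp ((h * t) ^ p) * (1 + C / h)) ^ Fintype.card ι := by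
  classical
  obtain ⟨C, hC, hsum⟩ := exists_sum_exp_neg_le hp
  refine ⟨C, hC, fun ι _ F t h ht hh hF => ?_⟩
  obtain ⟨M, hM⟩ : ∃ M : ℕ, F ⊆ Fintype.piFinset fun _ => Finset.Icc (-M : ℤ) M := by
    refine ⟨∑ n ∈ F, ∑ i, (n i).natAbs, fun n hn => ?_⟩
    rw [Fintype.mem_piFinset]
    intro i
    have h1 : (n i).natAbs ≤ ∑ i, (n i).natAbs :=
      Finset.single_le_sum (f := fun i => (n i).natAbs) (fun _ _ => Nat.zero_le _)
        (Finset.mem_univ i)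
    have h2 : ∑ i, (n i).natAbs ≤ ∑ n ∈ F, ∑ i, (n i).natAbs :=
      Finset.single_le_sum (f := fun n : ι → ℤ => ∑ i, (n i).natAbs) (fun _ _ => Nat.zero_le _) hn
    rw [Finset.mem_Icc]
    omega
  -- Chernoff's trick: each counted point has exponential weight at least `1`, and the total weight
  -- over a box factorises over coordinates. The parameter `h` stays free for later optimisation.
  have hterm : ∀ n ∈ F, (1 : ℝ) ≤ ∏ i, (Real.exp ((h * t) ^ p) *
      Real.exp (-(h * |(n i : ℝ)|) ^ p)) := by
    intro n hn
    rw [Finset.prod_mul_distrib, Finset.prod_const, ← Real.exp_sum, Finset.card_univ,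
      ← Real.exp_nat_mul, ← Real.exp_add, Real.one_le_exp_iff, Finset.sum_neg_distrib]
    have e : ∑ i, (h * |(n i : ℝ)|) ^ p = h ^ p * ∑ i, |(n i : ℝ)| ^ p := by
      rw [Finset.mul_sum]
      exact Finset.sum_congr rfl fun i _ => Real.mul_rpow hh.le (abs_nonneg _)
    rw [e, Real.mul_rpow hh.le ht]
    have := mul_le_mul_of_nonneg_left (hF n hn) (Real.rpow_nonneg hh.le p)
    linarith
  calc (F.card : ℝ) = ∑ n ∈ F, (1 : ℝ) := by simp
    _ ≤ ∑ n ∈ F, ∏ i, (Real.exp ((h * t) ^ p) * Real.exp (-(h * |(n i : ℝ)|) ^ p)) :=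
        Finset.sum_le_sum hterm
    _ ≤ ∑ n ∈ Fintype.piFinset fun _ : ι => Finset.Icc (-M : ℤ) M,
          ∏ i, (Real.exp ((h * t) ^ p) * Real.exp (-(h * |(n i : ℝ)|) ^ p)) :=
        Finset.sum_le_sum_of_subset_of_nonneg hM fun n _ _ =>
          Finset.prod_nonneg fun i _ => by positivity
    _ = ∏ _i : ι, ∑ a ∈ Finset.Icc (-M : ℤ) M,
          (Real.exp ((h * t) ^ p) * Real.exp (-(h * |(a : ℝ)|) ^ p)) :=
        (Finset.prod_univ_sum (fun _ : ι => Finset.Icc (-M : ℤ) M) fun _ a =>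
          Real.exp ((h * t) ^ p) * Real.exp (-(h * |(a : ℝ)|) ^ p)).symm
    _ = (Real.exp ((h * t) ^ p) *
          ∑ a ∈ Finset.Icc (-M : ℤ) M, Real.exp (-(h * |(a : ℝ)|) ^ p)) ^ Fintype.card ι := by
        rw [← Finset.mul_sum, Finset.prod_const, Finset.card_univ]
    _ ≤ _ := by
        gcongr
        exact hsum h M hh

end Counting

/-! ### Comparison of the Morrey norm with the sup norm and the `p`-mean. -/

section Norm

variable {d j : ℕ}

theorem dyadicCube_zero_subset_iff (ν : ℕ) (k m : Fin d → ℤ) :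
    dyadicCube 0 k ⊆ dyadicCube (-(ν : ℤ)) m ↔
      ∀ i, 2 ^ ν * m i ≤ k i ∧ k i < 2 ^ ν * (m i + 1) := by
  constructor
  · intro h i
    have hx : (fun i => (k i : ℝ)) ∈ dyadicCube 0 k := fun i => by simp
    have := h hx i
    simp only [neg_neg, zpow_natCast] at this
    exact ⟨by exact_mod_cast this.1, by exact_mod_cast this.2⟩
  · intro h x hx i
    have hxi := hx i
    simp only [neg_zero, zpow_zero, one_mul] at hxi
    have h1 : (2 : ℝ) ^ ν * m i ≤ k i := by exact_mod_cast (h i).1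
    have h2 : (k i : ℝ) + 1 ≤ 2 ^ ν * (m i + 1) := by
      exact_mod_cast Int.add_one_le_of_lt (h i).2
    simp only [neg_neg, zpow_natCast]
    exact ⟨h1.trans hxi.1, hxi.2.trans_le h2⟩

theorem card_piFinset_Ico (ν : ℕ) (m : Fin d → ℤ) :
    (Fintype.piFinset fun i => Finset.Ico (2 ^ ν * m i) (2 ^ ν * (m i + 1))).card =
      2 ^ (ν * d) := by
  have : ∀ i, (2 ^ ν * (m i + 1) - 2 ^ ν * m i : ℤ).toNat = 2 ^ ν := fun i => by
    have e : (2 ^ ν * (m i + 1) - 2 ^ ν * m i : ℤ) = ((2 ^ ν : ℕ) : ℤ) := by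
      push_cast
      ring
    rw [e, Int.toNat_natCast]
  simp [Fintype.card_piFinset, this, pow_mul]

theorem card_indexSet (d j : ℕ) : Fintype.card (indexSet d j) = 2 ^ (j * d) := by
  rw [← card_piFinset_Ico j (0 : Fin d → ℤ), ← Fintype.card_coe]
  refine Fintype.card_congr (Equiv.subtypeEquivRight fun k => ?_)
  simp only [indexSet, Set.mem_ofPred_eq, dyadicCube_zero_subset_iff, Fintype.mem_piFinset,
    Finset.mem_Ico]

open Classical in
theorem card_filter_dyadicCube_le (ν : ℕ) (m : Fin d → ℤ) :
    (Finset.univ.filter fun k : indexSet d j =>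
      dyadicCube 0 k.1 ⊆ dyadicCube (-(ν : ℤ)) m).card ≤ 2 ^ (ν * d) := by
  rw [← card_piFinset_Ico ν m]
  refine Finset.card_le_card_of_injOn (fun k => k.1) (fun k hk => ?_)
    fun _ _ _ _ h => Subtype.ext h
  simpa [dyadicCube_zero_subset_iff] using hk

/-- The largest cube `Q_{-j,0}`. -/
def topCube (d j : ℕ) : SubCube d j := ⟨(j, 0), subset_rfl⟩

theorem SubCube.two_pow_le (q : SubCube d j) : (2 : ℝ) ^ (q.1.1 * d) ≤ 2 ^ (j * d) := by
  rw [← volume_dyadicCube q.1.1 q.1.2, ← volume_dyadicCube j (0 : Fin d → ℤ)]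
  refine ENNReal.toReal_mono (fun h => ?_) (measure_mono q.2)
  have := volume_dyadicCube j (0 : Fin d → ℤ)
  rw [h, ENNReal.toReal_top] at this
  exact (pow_pos two_pos _).ne this

/-- A cube `Q` contains at most `|Q|` indices, so its term is at most `|Q|^{1/u} s`, and `|Q| ≤
2^{jd}`. -/
theorem norm_le_of_forall_le {u p : ℝ} (hp : 0 < p) (hu : 0 < u) (lam : Space d j u p) {s : ℝ}
    (hs : 0 ≤ s) (h : ∀ k, ‖(lam k : ℂ)‖ ≤ s) :
    ‖lam‖ ≤ ((2 : ℝ) ^ (j * d)) ^ (1 / u) * s := by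
  classical
  have : Nonempty (SubCube d j) := ⟨topCube d j⟩
  refine ciSup_le fun q => ?_
  unfold cubeTerm
  rw [SubCube.cube, volume_dyadicCube]
  set V : ℝ := (2 : ℝ) ^ (q.1.1 * d) with hV
  have hVpos : 0 < V := by positivity
  have h1 : ∑ k : indexSet d j with dyadicCube 0 k.1 ⊆ dyadicCube (-(q.1.1 : ℤ)) q.1.2,
      ‖(lam k : ℂ)‖ ^ p ≤ V * s ^ p := by
    refine (Finset.sum_le_card_nsmul _ _ (s ^ p) fun k _ => ?_).trans ?_
    · exact Real.rpow_le_rpow (norm_nonneg _) (h k) hp.le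
    · rw [nsmul_eq_mul]
      refine mul_le_mul_of_nonneg_right ?_ (Real.rpow_nonneg hs p)
      rw [hV]
      exact_mod_cast card_filter_dyadicCube_le q.1.1 q.1.2
  calc _ ≤ V ^ (1 / u - 1 / p) * (V * s ^ p) ^ (1 / p) := by
        refine mul_le_mul_of_nonneg_left (Real.rpow_le_rpow ?_ (by convert h1) (by positivity))
          (by positivity)
        exact Finset.sum_nonneg fun _ _ => Real.rpow_nonneg (norm_nonneg _) _
    _ = V ^ (1 / u) * s := by
        rw [Real.mul_rpow hVpos.le (Real.rpow_nonneg hs p), ← mul_assoc, ← Real.rpow_add hVpos,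
          ← Real.rpow_mul hs, mul_one_div_cancel hp.ne', Real.rpow_one]
        congr 2
        ring
    _ ≤ _ := by
        gcongr
        exact q.two_pow_le

theorem sum_rpow_le_of_norm_le {u p : ℝ} (hp : 0 < p) (hpu : p ≤ u) (lam : Space d j u p) {r : ℝ}
    (h : ‖lam‖ ≤ r) :
    ∑ k, ‖(lam k : ℂ)‖ ^ p ≤ (2 : ℝ) ^ (j * d) * (r * ((2 : ℝ) ^ (j * d)) ^ (-(1 / u))) ^ p := by
  classical
  have h1 : cubeTerm u p lam (topCube d j) ≤ r :=
    (le_ciSup (bddAbove_cubeTerm hp hpu lam) (topCube d j)).trans h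
  unfold cubeTerm at h1
  have h2 : Finset.univ.filter (fun k : indexSet d j => dyadicCube 0 k.1 ⊆ (topCube d j).cube) =
      Finset.univ := Finset.filter_true_of_mem fun k _ => k.2
  have h3 : (volume (topCube d j).cube).toReal = 2 ^ (j * d) := volume_dyadicCube j 0
  rw [h3] at h1
  set V : ℝ := (2 : ℝ) ^ (j * d) with hV
  have hVpos : 0 < V := by positivity
  set S := ∑ k : indexSet d j, ‖(lam k : ℂ)‖ ^ p with hS
  have hS0 : 0 ≤ S := Finset.sum_nonneg fun _ _ => Real.rpow_nonneg (norm_nonneg _) _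
  have h4 : V ^ (1 / u - 1 / p) * S ^ (1 / p) ≤ r := by
    convert h1 using 4
    exact h2.symm
  have h5 : S ^ (1 / p) ≤ V ^ (1 / p) * (r * V ^ (-(1 / u))) := by
    calc S ^ (1 / p) = V ^ (1 / p) * (V ^ (1 / u - 1 / p) * S ^ (1 / p) * V ^ (-(1 / u))) := by
          rw [Real.rpow_sub hVpos, Real.rpow_neg hVpos.le]
          field_simp
      _ ≤ _ := by gcongr
  have hr : 0 ≤ r := le_trans (by positivity) h4
  calc S = (S ^ (1 / p)) ^ p := by
        rw [← Real.rpow_mul hS0, one_div_mul_cancel hp.ne', Real.rpow_one]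
    _ ≤ (V ^ (1 / p) * (r * V ^ (-(1 / u)))) ^ p :=
        Real.rpow_le_rpow (Real.rpow_nonneg hS0 _) h5 hp.le
    _ = _ := by
        rw [Real.mul_rpow (by positivity) (by positivity), ← Real.rpow_mul hVpos.le,
          one_div_mul_cancel hp.ne', Real.rpow_one]

end Norm

/-! ### Real coordinates and grids. -/

section Grid

variable {d j : ℕ}

/-- Rounding towards zero: it never increases the `p`-mean, so no quasi-triangle constant is lost.
-/
theorem exists_int_abs_le (y : ℝ) : ∃ n : ℤ, |(n : ℝ)| ≤ |y| ∧ |y - n| ≤ 1 := by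
  rcases le_total 0 y with h | h
  · refine ⟨⌊y⌋, ?_, ?_⟩
    · rw [abs_of_nonneg h, abs_of_nonneg (by exact_mod_cast Int.floor_nonneg.2 h)]
      exact Int.floor_le y
    · rw [abs_le]
      constructor <;> linarith [Int.floor_le y, Int.lt_floor_add_one y]
  · refine ⟨⌈y⌉, ?_, ?_⟩
    · rw [abs_of_nonpos h, abs_of_nonpos (by exact_mod_cast Int.ceil_nonpos.2 h)]
      exact neg_le_neg (Int.le_ceil y)
    · rw [abs_le]
      constructor <;> linarith [Int.le_ceil y, Int.ceil_lt_add_one y]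

/-- The real and imaginary parts of the members of a family. -/
def realCoord {u p : ℝ} (lam : Space d j u p) (i : indexSet d j × Bool) : ℝ :=
  bif i.2 then (lam i.1 : ℂ).re else (lam i.1 : ℂ).im

/-- The family whose real coordinates are `δ` times given integers. -/
def gridPoint (u p δ : ℝ) (n : indexSet d j × Bool → ℤ) : Space d j u p :=
  fun k => (⟨δ * n (k, true), δ * n (k, false)⟩ : ℂ)

theorem realCoord_gridPoint (u p δ : ℝ) (n : indexSet d j × Bool → ℤ)
    (i : indexSet d j × Bool) : realCoord (gridPoint u p δ n) i = δ * n i := by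
  obtain ⟨k, b⟩ := i
  cases b <;> rfl

theorem realCoord_sub {u p : ℝ} (x y : Space d j u p) (i : indexSet d j × Bool) :
    realCoord (x - y) i = realCoord x i - realCoord y i := by
  obtain ⟨k, b⟩ := i
  cases b
  · exact Complex.sub_im _ _
  · exact Complex.sub_re _ _

theorem norm_le_of_abs_realCoord_le {u p : ℝ} {lam : Space d j u p} {s : ℝ}
    (h : ∀ i, |realCoord lam i| ≤ s) (k : indexSet d j) : ‖(lam k : ℂ)‖ ≤ 2 * s := by
  have h1 := h (k, true)
  have h2 := h (k, false)
  have := Complex.norm_le_abs_re_add_abs_im (lam k)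
  simp only [realCoord, cond_true, cond_false] at h1 h2
  linarith

theorem sum_abs_realCoord_rpow_le {u p : ℝ} (hp : 0 < p) (lam : Space d j u p) :
    ∑ i, |realCoord lam i| ^ p ≤ 2 * ∑ k, ‖(lam k : ℂ)‖ ^ p := by
  rw [Fintype.sum_prod_type, Finset.mul_sum]
  refine Finset.sum_le_sum fun k _ => ?_
  have h1 : |(lam k : ℂ).re| ^ p ≤ ‖(lam k : ℂ)‖ ^ p :=
    Real.rpow_le_rpow (abs_nonneg _) (Complex.abs_re_le_norm _) hp.le
  have h2 : |(lam k : ℂ).im| ^ p ≤ ‖(lam k : ℂ)‖ ^ p :=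
    Real.rpow_le_rpow (abs_nonneg _) (Complex.abs_im_le_norm _) hp.le
  simp only [Fintype.sum_bool, realCoord, cond_true, cond_false]
  linarith

theorem sum_abs_realCoord_rpow_le_of_norm_le {u p : ℝ} (hp : 0 < p) (hpu : p ≤ u)
    {lam : Space d j u p} {r : ℝ} (h : ‖lam‖ ≤ r) :
    ∑ i, |realCoord lam i| ^ p ≤
      2 * (2 : ℝ) ^ (j * d) * (r * ((2 : ℝ) ^ (j * d)) ^ (-(1 / u))) ^ p := by
  have h1 := sum_abs_realCoord_rpow_le hp lam
  have h2 := sum_rpow_le_of_norm_le hp hpu lam h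
  linarith

theorem card_indexSet_prod_bool (d j : ℕ) :
    Fintype.card (indexSet d j × Bool) = 2 * 2 ^ (j * d) := by
  rw [Fintype.card_prod, card_indexSet, Fintype.card_bool, mul_comm]

end Grid

/-! ### Upper bound: covering the unit ball. -/

section Upper

/-- Bounding all finite subsets also forces `S` to be finite; spare indices of the enumeration are
sent to a fixed point. -/
theorem exists_fin_cover {α : Type*} (S : Set α) (K : ℕ) (hS : S.Nonempty)
    (h : ∀ F : Finset α, (F : Set α) ⊆ S → F.card ≤ K) :
    ∃ f : Fin K → α, ∀ a ∈ S, ∃ i, f i = a := by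
  have hfin : S.Finite := by
    by_contra hinf
    obtain ⟨F, hF, hcard⟩ := Set.Infinite.exists_subset_card_eq hinf (K + 1)
    have := h F hF
    omega
  obtain ⟨a₀, _⟩ := hS
  have hcard := h hfin.toFinset (by simp)
  let e := hfin.toFinset.equivFin
  refine ⟨fun i => if hi : i.1 < hfin.toFinset.card then (e.symm ⟨i.1, hi⟩).1 else a₀,
    fun a ha => ?_⟩
  have ha' : a ∈ hfin.toFinset := hfin.mem_toFinset.2 ha
  refine ⟨⟨(e ⟨a, ha'⟩).1, (e ⟨a, ha'⟩).2.trans_le hcard⟩, ?_⟩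
  simp

theorem entropyNumber_le {X Y : Type*} [AddCommGroup X] [Module ℂ X] [Norm X]
    [AddCommGroup Y] [Module ℂ Y] [Norm Y] {k : ℕ} {T : X →ₗ[ℂ] Y} {ε : ℝ} (hε : 0 < ε)
    (y : Fin (2 ^ (k - 1)) → Y) (hy : ∀ x : X, ‖x‖ ≤ 1 → ∃ i, ‖T x - y i‖ ≤ ε) :
    entropyNumber k T ≤ ε :=
  csInf_le ⟨0, fun _ h => h.1.le⟩ ⟨hε, y, hy⟩

/-- Truncating real coordinates to a grid gives a covering of the unit ball. -/
theorem exists_cover_of_card_le {p₁ : ℝ} (hp₁ : 0 < p₁) :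
    ∃ C : ℝ, 0 < C ∧ ∀ (d j K : ℕ) (u₁ u₂ p₂ η h : ℝ), p₁ ≤ u₁ → 0 < p₂ → 0 < u₂ → 0 < η → 0 < h →
      (Real.exp ((h * (1 / η)) ^ p₁) * (1 + C / h)) ^ (2 * 2 ^ (j * d)) ≤ K →
      ∃ y : Fin K → Space d j u₂ p₂, ∀ x : Space d j u₁ p₁, ‖x‖ ≤ 1 →
        ∃ i, ‖idMap d j u₁ p₁ u₂ p₂ x - y i‖ ≤
          ((2 : ℝ) ^ (j * d)) ^ (1 / u₂) * (2 * (η * ((2 : ℝ) ^ (j * d)) ^ (-(1 / u₁)))) := by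
  obtain ⟨C, hC, hcount⟩ := exists_card_le_of_sum_rpow_le hp₁
  refine ⟨C, hC, fun d j K u₁ u₂ p₂ η h hpu₁ hp₂ hu₂ hη hh hK => ?_⟩
  set V : ℝ := (2 : ℝ) ^ (j * d) with hV
  have hVpos : 0 < V := by positivity
  have hcardV : (Fintype.card (indexSet d j × Bool) : ℝ) = 2 * V := by
    rw [card_indexSet_prod_bool, hV]
    push_cast
    rfl
  set δ : ℝ := η * V ^ (-(1 / u₁)) with hδdef
  have hδ : 0 < δ := by positivity
  obtain ⟨f, hf⟩ := exists_fin_cover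
    {n : indexSet d j × Bool → ℤ | ∑ i, |(n i : ℝ)| ^ p₁ ≤
      Fintype.card (indexSet d j × Bool) * (1 / η) ^ p₁} K
    ⟨0, by
      simp only [Set.mem_ofPred_eq, Pi.zero_apply, Int.cast_zero, abs_zero,
        Real.zero_rpow hp₁.ne', Finset.sum_const_zero]
      positivity⟩
    (fun F hF => by
      have := hcount _ F (1 / η) h (by positivity) hh fun n hn => hF hn
      rw [card_indexSet_prod_bool] at this
      exact_mod_cast this.trans hK)
  refine ⟨fun i => gridPoint u₂ p₂ δ (f i), fun x hx => ?_⟩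
  choose n hn1 hn2 using fun i => exists_int_abs_le (realCoord x i / δ)
  have hmem : ∑ i, |(n i : ℝ)| ^ p₁ ≤
      Fintype.card (indexSet d j × Bool) * (1 / η) ^ p₁ := by
    have h1 := sum_abs_realCoord_rpow_le_of_norm_le hp₁ hpu₁ hx
    calc ∑ i, |(n i : ℝ)| ^ p₁ ≤ ∑ i, |realCoord x i| ^ p₁ * (1 / δ) ^ p₁ := by
          refine Finset.sum_le_sum fun i _ => ?_
          rw [← Real.mul_rpow (abs_nonneg _) (by positivity)]
          refine Real.rpow_le_rpow (abs_nonneg _) ((hn1 i).trans ?_) hp₁.le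
          rw [abs_div, abs_of_pos hδ, mul_one_div]
      _ = (∑ i, |realCoord x i| ^ p₁) * (1 / δ) ^ p₁ := by rw [Finset.sum_mul]
      _ ≤ (2 * V * (1 * V ^ (-(1 / u₁))) ^ p₁) * (1 / δ) ^ p₁ := by gcongr
      _ = _ := by
          rw [hcardV, mul_assoc, ← Real.mul_rpow (by positivity) (by positivity)]
          congr 2
          rw [hδdef]
          field_simp
  obtain ⟨i, hi⟩ := hf n hmem
  refine ⟨i, norm_le_of_forall_le hp₂ hu₂ _ (by positivity) fun k => ?_⟩
  refine norm_le_of_abs_realCoord_le (fun l => ?_) k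
  have e : realCoord (idMap d j u₁ p₁ u₂ p₂ x) l = realCoord x l := rfl
  rw [realCoord_sub, realCoord_gridPoint, hi, e]
  calc |realCoord x l - δ * n l| = |δ * (realCoord x l / δ - n l)| := by
        rw [mul_sub, mul_div_cancel₀ _ hδ.ne']
    _ = δ * |realCoord x l / δ - n l| := by rw [abs_mul, abs_of_pos hδ]
    _ ≤ δ * 1 := by
        gcongr
        exact hn2 l
    _ = δ := mul_one δ

/-- Grid width `B * 2^{-κ}` keeps the count per coordinate below `2^κ`, even when `2^κ` is close to
`1`. -/
theorem exists_grid_parameters {C p c : ℝ} (hC : 0 < C) (hp : 0 < p) (hc : 0 < c) :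
    ∃ B : ℝ, 0 < B ∧ ∀ κ : ℝ, c ≤ κ → ∃ h : ℝ, 0 < h ∧
      Real.exp ((h * (1 / (B * (2 : ℝ) ^ (-κ)))) ^ p) * (1 + C / h) ≤ 2 ^ κ := by
  have hb : 1 < (2 : ℝ) ^ (c / 2) := Real.one_lt_rpow one_lt_two (by positivity)
  have hlog : 0 < c / 2 * Real.log 2 := by
    have := Real.log_pos one_lt_two
    positivity
  set w : ℝ := (c / 2 * Real.log 2) ^ (1 / p) with hw
  have hwpos : 0 < w := Real.rpow_pos_of_pos hlog _
  set h₀ : ℝ := C / ((2 : ℝ) ^ (c / 2) - 1) with hh₀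
  have hh₀pos : 0 < h₀ := div_pos hC (by linarith)
  -- The first summand serves `κ ≤ 3`: with `h = h₀` both factors are at most `2^{c/2}`. The second
  -- serves `κ ≥ 3`: with `h` the grid width, the product is at most `e + 2^κ / 2`.
  set B : ℝ := 8 * h₀ / w + 2 * (Real.exp 1 * C) with hB
  have hBpos : 0 < B := by positivity
  refine ⟨B, hBpos, fun κ hκ => ?_⟩
  have h2κ : (0 : ℝ) < 2 ^ κ := Real.rpow_pos_of_pos two_pos κ
  have eη : 1 / (B * (2 : ℝ) ^ (-κ)) = 2 ^ κ / B := by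
    rw [Real.rpow_neg two_pos.le]
    field_simp
  rw [eη]
  have h8 : (2 : ℝ) ^ (3 : ℝ) = 8 := by norm_num
  rcases le_total κ 3 with h3 | h3
  · refine ⟨h₀, hh₀pos, ?_⟩
    have e1 : 1 + C / h₀ = 2 ^ (c / 2) := by
      have : (2 : ℝ) ^ (c / 2) - 1 ≠ 0 := by linarith
      rw [hh₀]
      field_simp
      ring
    have h4 : (2 : ℝ) ^ κ ≤ 8 := by
      rw [← h8]
      exact Real.rpow_le_rpow_of_exponent_le one_le_two h3
    have h5 : h₀ * (2 ^ κ / B) ≤ w := by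
      rw [← mul_div_assoc, div_le_iff₀ hBpos]
      have e2 : w * B = 8 * h₀ + w * (2 * (Real.exp 1 * C)) := by
        rw [hB]
        field_simp
      have : 0 < w * (2 * (Real.exp 1 * C)) := by positivity
      nlinarith
    have h6 : (h₀ * (2 ^ κ / B)) ^ p ≤ c / 2 * Real.log 2 := by
      refine (Real.rpow_le_rpow (by positivity) h5 hp.le).trans_eq ?_
      rw [hw, ← Real.rpow_mul hlog.le, one_div_mul_cancel hp.ne', Real.rpow_one]
    rw [e1]
    calc _ ≤ Real.exp (c / 2 * Real.log 2) * 2 ^ (c / 2) := by gcongr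
      _ = 2 ^ c := by
          rw [mul_comm (c / 2), ← Real.rpow_def_of_pos two_pos, ← Real.rpow_add two_pos]
          congr 1
          ring
      _ ≤ 2 ^ κ := Real.rpow_le_rpow_of_exponent_le one_le_two hκ
  · refine ⟨B / 2 ^ κ, by positivity, ?_⟩
    have e1 : B / 2 ^ κ * (2 ^ κ / B) = 1 := by field_simp
    rw [e1, Real.one_rpow]
    have h4 : (8 : ℝ) ≤ 2 ^ κ := by
      rw [← h8]
      exact Real.rpow_le_rpow_of_exponent_le one_le_two h3
    have h5 : Real.exp 1 * (C / (B / 2 ^ κ)) ≤ 2 ^ κ / 2 := by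
      have e2 : Real.exp 1 * (C / (B / 2 ^ κ)) = (Real.exp 1 * C) * 2 ^ κ / B := by field_simp
      rw [e2, div_le_iff₀ hBpos]
      have : 2 * (Real.exp 1 * C) ≤ B := by
        have : 0 < 8 * h₀ / w := by positivity
        linarith
      nlinarith
    have := Real.exp_one_lt_d9
    linarith

theorem two_rpow_mul_sub_eq (d j : ℕ) (a b : ℝ) :
    (2 : ℝ) ^ ((j : ℝ) * (d : ℝ) * (a - b)) =
      ((2 : ℝ) ^ (j * d)) ^ a * ((2 : ℝ) ^ (j * d)) ^ (-b) := by
  rw [← Real.rpow_add (by positivity), ← Real.rpow_natCast 2 (j * d), ← Real.rpow_mul two_pos.le]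
  push_cast
  rfl

/-- The case `k = 1`, where a single ball is available: then `V ≤ 1 / c` is bounded, and each entry
is controlled by the full `p₁`-sum. -/
theorem exists_cover_one {d j : ℕ} {u₁ p₁ u₂ p₂ c : ℝ} (hp₁ : 0 < p₁) (hpu₁ : p₁ ≤ u₁)
    (hp₂ : 0 < p₂) (hu₂ : 0 < u₂) (hc : 0 < c) (h : c * (2 : ℝ) ^ (j * d) ≤ 1)
    (x : Space d j u₁ p₁) (hx : ‖x‖ ≤ 1) :
    ‖idMap d j u₁ p₁ u₂ p₂ x - 0‖ ≤ ((2 : ℝ) ^ (j * d)) ^ (1 / u₂) *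
      ((1 / c) ^ (1 / p₁) * ((2 : ℝ) ^ (j * d)) ^ (-(1 / u₁))) := by
  rw [sub_zero]
  refine norm_le_of_forall_le hp₂ hu₂ _ (by positivity) fun k => ?_
  have h1 := sum_rpow_le_of_norm_le hp₁ hpu₁ x hx
  set V : ℝ := (2 : ℝ) ^ (j * d) with hV
  have hVpos : 0 < V := by positivity
  have h2 : ‖(x k : ℂ)‖ ^ p₁ ≤ V * (1 * V ^ (-(1 / u₁))) ^ p₁ :=
    (Finset.single_le_sum (f := fun k => ‖(x k : ℂ)‖ ^ p₁)
      (fun _ _ => Real.rpow_nonneg (norm_nonneg _) _) (Finset.mem_univ k)).trans h1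
  have hVc : V ≤ 1 / c := by
    rw [le_div_iff₀ hc]
    linarith
  have h3 : ‖(x k : ℂ)‖ ^ p₁ ≤ ((1 / c) ^ (1 / p₁) * V ^ (-(1 / u₁))) ^ p₁ := by
    rw [Real.mul_rpow (by positivity) (by positivity), ← Real.rpow_mul (by positivity),
      one_div_mul_cancel hp₁.ne', Real.rpow_one]
    rw [one_mul] at h2
    exact h2.trans (by gcongr)
  exact (Real.rpow_le_rpow_iff (norm_nonneg _) (by positivity) hp₁).1 h3

theorem exists_cover_unitBall (d : ℕ) {u₁ p₁ u₂ p₂ c : ℝ} (hp₁ : 0 < p₁) (hpu₁ : p₁ ≤ u₁)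
    (hp₂ : 0 < p₂) (hu₂ : 0 < u₂) (hc : 0 < c) :
    ∃ B : ℝ, 0 < B ∧ ∀ j k : ℕ, c * (2 : ℝ) ^ (j * d) ≤ (k : ℝ) →
      ∃ y : Fin (2 ^ (k - 1)) → Space d j u₂ p₂, ∀ x : Space d j u₁ p₁, ‖x‖ ≤ 1 →
        ∃ i, ‖idMap d j u₁ p₁ u₂ p₂ x - y i‖ ≤
          B * ((2 : ℝ) ^ (-(k : ℝ) / (2 * (2 : ℝ) ^ (j * d))) *
            (2 : ℝ) ^ ((j : ℝ) * (d : ℝ) * (1 / u₂ - 1 / u₁))) := by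
  obtain ⟨C, hC, hcover⟩ := exists_cover_of_card_le hp₁
  -- For `k ≥ 2`, `k - 1 ≥ k / 2`, hence `(k - 1) / (2V) ≥ c / 4`.
  obtain ⟨B, hB, hpar⟩ := exists_grid_parameters (c := c / 4) hC hp₁ (by positivity)
  -- In `4 * B`, one factor `2` passes from real coordinates to moduli and one from `k - 1` to `k`;
  -- the other summand covers `k = 1`.
  refine ⟨4 * B + 2 * (1 / c) ^ (1 / p₁), by positivity, fun j k hk => ?_⟩
  rw [two_rpow_mul_sub_eq]
  have hV1 : (1 : ℝ) ≤ 2 ^ (j * d) := one_le_pow₀ one_le_two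
  set V : ℝ := (2 : ℝ) ^ (j * d) with hV
  have hVpos : 0 < V := by positivity
  have hk0 : 0 < (k : ℝ) := lt_of_lt_of_le (by positivity) hk
  have hhalf : (2 : ℝ) ^ (1 / (2 * V)) ≤ 2 := by
    conv_rhs => rw [← Real.rpow_one 2]
    refine Real.rpow_le_rpow_of_exponent_le one_le_two ?_
    rw [div_le_one (by positivity)]
    linarith
  have hshift : (2 : ℝ) ^ (-((k - 1 : ℝ) / (2 * V))) ≤ 2 * 2 ^ (-(k : ℝ) / (2 * V)) := by
    have e : -((k - 1 : ℝ) / (2 * V)) = 1 / (2 * V) + -(k : ℝ) / (2 * V) := by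
      field_simp
      ring
    rw [e, Real.rpow_add two_pos]
    gcongr
  obtain rfl | hk2 : k = 1 ∨ 2 ≤ k := by
    have : 0 < k := by exact_mod_cast hk0
    omega
  · refine ⟨fun _ => 0, fun x hx => ⟨⟨0, by simp⟩, ?_⟩⟩
    refine (exists_cover_one hp₁ hpu₁ hp₂ hu₂ hc (by simpa using hk) x hx).trans ?_
    have h1 : 1 ≤ 2 * (2 : ℝ) ^ (-((1 : ℕ) : ℝ) / (2 * V)) := by
      simpa using hshift
    set E : ℝ := (2 : ℝ) ^ (-((1 : ℕ) : ℝ) / (2 * V)) with hE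
    have hE0 : 0 < E := by positivity
    calc V ^ (1 / u₂) * ((1 / c) ^ (1 / p₁) * V ^ (-(1 / u₁)))
        = 1 * ((1 / c) ^ (1 / p₁) * (V ^ (1 / u₂) * V ^ (-(1 / u₁)))) := by ring
      _ ≤ (2 * E) * ((1 / c) ^ (1 / p₁) * (V ^ (1 / u₂) * V ^ (-(1 / u₁)))) := by gcongr
      _ = 2 * (1 / c) ^ (1 / p₁) * (E * (V ^ (1 / u₂) * V ^ (-(1 / u₁)))) := by ring
      _ ≤ _ := by
          gcongr
          linarith
  · have hk2' : (2 : ℝ) ≤ k := by exact_mod_cast hk2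
    obtain ⟨h, hh, hle⟩ := hpar ((k - 1 : ℝ) / (2 * V)) (by
      rw [le_div_iff₀ (by positivity)]
      linarith)
    set κ : ℝ := (k - 1 : ℝ) / (2 * V) with hκ
    have hη : 0 < B * (2 : ℝ) ^ (-κ) := by positivity
    obtain ⟨y, hy⟩ := hcover d j (2 ^ (k - 1)) u₁ u₂ p₂ (B * (2 : ℝ) ^ (-κ)) h hpu₁ hp₂ hu₂ hη hh (by
      refine (pow_le_pow_left₀ (by positivity) hle _).trans_eq ?_
      rw [← Real.rpow_natCast, ← Real.rpow_mul two_pos.le]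
      have e : κ * ((2 * 2 ^ (j * d) : ℕ) : ℝ) = ((k - 1 : ℕ) : ℝ) := by
        have : ((2 * 2 ^ (j * d) : ℕ) : ℝ) = 2 * V := by
          rw [hV]
          push_cast
          rfl
        rw [this, Nat.cast_sub (by omega), Nat.cast_one, hκ]
        field_simp
      rw [e, Real.rpow_natCast]
      push_cast
      rfl)
    refine ⟨y, fun x hx => ?_⟩
    obtain ⟨i, hi⟩ := hy x hx
    refine ⟨i, hi.trans ?_⟩
    set E : ℝ := (2 : ℝ) ^ (-(k : ℝ) / (2 * V)) with hE
    have hE0 : 0 < E := by positivity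
    calc V ^ (1 / u₂) * (2 * (B * (2 : ℝ) ^ (-κ) * V ^ (-(1 / u₁))))
        ≤ V ^ (1 / u₂) * (2 * (B * (2 * E) * V ^ (-(1 / u₁)))) := by gcongr
      _ = 4 * B * (E * (V ^ (1 / u₂) * V ^ (-(1 / u₁)))) := by ring
      _ ≤ _ := by
          gcongr
          have : 0 < (1 / c) ^ (1 / p₁) := by positivity
          linarith

end Upper

/-! ### Lower bound: counting grid points in balls. -/

section Lower

theorem abs_sub_rpow_le {p : ℝ} (hp : 0 < p) (x y : ℝ) :
    |x - y| ^ p ≤ 2 ^ p * (|x| ^ p + |y| ^ p) := by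
  have hx := Real.rpow_nonneg (abs_nonneg x) p
  have hy := Real.rpow_nonneg (abs_nonneg y) p
  have h1 : |x - y| ≤ 2 * max |x| |y| := by
    have := abs_sub x y
    have := le_max_left |x| |y|
    have := le_max_right |x| |y|
    linarith
  calc |x - y| ^ p ≤ (2 * max |x| |y|) ^ p := Real.rpow_le_rpow (abs_nonneg _) h1 hp.le
    _ = 2 ^ p * (max |x| |y|) ^ p := Real.mul_rpow two_pos.le (by positivity)
    _ ≤ _ := by
        gcongr
        rcases max_choice |x| |y| with h | h <;> rw [h] <;> linarith

/-- A ball of radius `ε` contains a bounded number (per coordinate) of points of a grid whose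
width is comparable to `ε`. -/
theorem exists_card_grid_le {p : ℝ} (hp : 0 < p) :
    ∃ D : ℝ, 1 ≤ D ∧ ∀ (d j : ℕ) (u ε : ℝ) (y : Space d j u p)
      (F : Finset (indexSet d j × Bool → ℤ)), p ≤ u → 0 < ε →
      (∀ n ∈ F, ‖gridPoint u p (2 * 2 ^ (1 / p) * (ε * ((2 : ℝ) ^ (j * d)) ^ (-(1 / u)))) n - y‖
        ≤ ε) → (F.card : ℝ) ≤ D ^ (2 * 2 ^ (j * d)) := by
  classical
  obtain ⟨C, hC, hcount⟩ := exists_card_le_of_sum_rpow_le hp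
  refine ⟨Real.exp 1 * (1 + C), ?_, fun d j u ε y F hpu hε hF => ?_⟩
  · have := Real.one_le_exp zero_le_one
    nlinarith
  set V : ℝ := (2 : ℝ) ^ (j * d) with hV
  have hVpos : 0 < V := by positivity
  have hcardV : (Fintype.card (indexSet d j × Bool) : ℝ) = 2 * V := by
    rw [card_indexSet_prod_bool, hV]
    push_cast
    rfl
  set δ : ℝ := 2 * 2 ^ (1 / p) * (ε * V ^ (-(1 / u))) with hδdef
  have hδ : 0 < δ := by positivity
  rcases F.eq_empty_or_nonempty with rfl | ⟨n₀, hn₀⟩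
  · simp only [Finset.card_empty, Nat.cast_zero]
    positivity
  have hδp : δ ^ p = 2 * (2 ^ p * (ε * V ^ (-(1 / u))) ^ p) := by
    rw [hδdef, Real.mul_rpow (by positivity) (by positivity),
      Real.mul_rpow (by positivity) (by positivity), ← Real.rpow_mul two_pos.le,
      one_div_mul_cancel hp.ne', Real.rpow_one]
    ring
  -- Differences from `n₀` eliminate the unknown centre `y`. The constant in `δ` is chosen so that
  -- they have `p`-mean at most `1`.
  have hcard := hcount _ (F.image (· - n₀)) 1 1 zero_le_one one_pos (by
    intro m hm
    obtain ⟨n, hn, rfl⟩ := Finset.mem_image.1 hm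
    rw [Real.one_rpow, mul_one, hcardV]
    have h1 := sum_abs_realCoord_rpow_le_of_norm_le hp hpu (hF n hn)
    have h2 := sum_abs_realCoord_rpow_le_of_norm_le hp hpu (hF n₀ hn₀)
    have hδppos : 0 < δ ^ p := by positivity
    refine le_of_mul_le_mul_left ?_ hδppos
    calc δ ^ p * ∑ i, |(((n - n₀) i : ℤ) : ℝ)| ^ p
        = ∑ i, |realCoord (gridPoint u p δ n - y) i - realCoord (gridPoint u p δ n₀ - y) i| ^ p := by
          rw [Finset.mul_sum]
          refine Finset.sum_congr rfl fun i _ => ?_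
          rw [← Real.mul_rpow hδ.le (abs_nonneg _), realCoord_sub, realCoord_sub,
            realCoord_gridPoint, realCoord_gridPoint, sub_sub_sub_cancel_right, ← mul_sub, abs_mul,
            abs_of_pos hδ]
          simp
      _ ≤ ∑ i, 2 ^ p * (|realCoord (gridPoint u p δ n - y) i| ^ p +
            |realCoord (gridPoint u p δ n₀ - y) i| ^ p) :=
          Finset.sum_le_sum fun i _ => abs_sub_rpow_le hp _ _
      _ = 2 ^ p * (∑ i, |realCoord (gridPoint u p δ n - y) i| ^ p +
            ∑ i, |realCoord (gridPoint u p δ n₀ - y) i| ^ p) := by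
          rw [← Finset.mul_sum, Finset.sum_add_distrib]
      _ ≤ 2 ^ p * (2 * V * (ε * V ^ (-(1 / u))) ^ p + 2 * V * (ε * V ^ (-(1 / u))) ^ p) := by
          gcongr
      _ = δ ^ p * (2 * V) := by
          rw [hδp]
          ring)
  rw [Finset.card_image_of_injective _ sub_left_injective, card_indexSet_prod_bool, mul_one,
    Real.one_rpow, div_one] at hcard
  exact hcard

theorem exists_le_of_cover {p₂ : ℝ} (hp₂ : 0 < p₂) :
    ∃ A : ℝ, 0 < A ∧ ∀ (d j k : ℕ) (u₁ p₁ u₂ ε : ℝ) (y : Fin (2 ^ (k - 1)) → Space d j u₂ p₂),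
      1 ≤ k → 0 < p₁ → 0 < u₁ → p₂ ≤ u₂ → 0 < ε →
      (∀ x : Space d j u₁ p₁, ‖x‖ ≤ 1 → ∃ i, ‖idMap d j u₁ p₁ u₂ p₂ x - y i‖ ≤ ε) →
      A * ((2 : ℝ) ^ (-(k : ℝ) / (2 * (2 : ℝ) ^ (j * d))) *
        (2 : ℝ) ^ ((j : ℝ) * (d : ℝ) * (1 / u₂ - 1 / u₁))) ≤ ε := by
  classical
  obtain ⟨D, hD, hgrid⟩ := exists_card_grid_le hp₂
  have hD0 : 0 < D := by linarith
  refine ⟨1 / (8 * D * 2 ^ (1 / p₂)), by positivity,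
    fun d j k u₁ p₁ u₂ ε y hk hp₁ hu₁ hpu₂ hε hy => ?_⟩
  rw [two_rpow_mul_sub_eq, neg_div, Real.rpow_neg two_pos.le]
  have hgridV := hgrid d j u₂ ε
  set V : ℝ := (2 : ℝ) ^ (j * d) with hV
  have hVpos : 0 < V := by positivity
  have hVnat : ((2 * 2 ^ (j * d) : ℕ) : ℝ) = 2 * V := by
    rw [hV]
    push_cast
    rfl
  set E : ℝ := (2 : ℝ) ^ ((k : ℝ) / (2 * V)) with hE
  have hE1 : 1 ≤ E := Real.one_le_rpow one_le_two (by positivity)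
  have hE0 : 0 < E := by linarith
  have hEpow : E ^ (2 * 2 ^ (j * d)) = 2 ^ k := by
    rw [← Real.rpow_natCast, hE, ← Real.rpow_mul two_pos.le, hVnat,
      div_mul_cancel₀ _ (by positivity), Real.rpow_natCast]
  -- `L` strictly exceeds `D * E`, so that counting gives a contradiction, yet is at most `2 * D *
  -- E` because `D * E ≥ 1`.
  set L : ℕ := ⌊D * E⌋₊ + 1 with hL
  have hL1 : D * E < L := by
    rw [hL]
    push_cast
    exact Nat.lt_floor_add_one _
  have hL2 : (L : ℝ) ≤ 2 * (D * E) := by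
    have h1 : (⌊D * E⌋₊ : ℝ) ≤ D * E := Nat.floor_le (by positivity)
    rw [hL]
    push_cast
    nlinarith
  set δ : ℝ := 2 * 2 ^ (1 / p₂) * (ε * V ^ (-(1 / u₂))) with hδdef
  have hδ : 0 < δ := by positivity
  -- Otherwise the grid cube with `L` points per real coordinate lies in the unit ball, and its
  -- `L^{2V}` points are too many for the covering balls.
  have key : 1 < V ^ (1 / u₁) * (2 * (δ * L)) := by
    by_contra! hcon
    let P : Finset (indexSet d j × Bool → ℤ) :=
      Fintype.piFinset fun _ => Finset.Ico (0 : ℤ) L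
    have hPcard : P.card = L ^ (2 * 2 ^ (j * d)) := by
      rw [← card_indexSet_prod_bool d j]
      simp [P, Fintype.card_piFinset]
    have hP : ∀ n ∈ P, ∃ i, ‖gridPoint u₂ p₂ δ n - y i‖ ≤ ε := by
      intro n hn
      refine hy (gridPoint u₁ p₁ δ n) ?_
      refine le_trans (norm_le_of_forall_le hp₁ hu₁ _ (by positivity) fun l =>
        norm_le_of_abs_realCoord_le (s := δ * L) (fun i => ?_) l) hcon
      have hi := Finset.mem_Ico.1 (Fintype.mem_piFinset.1 hn i)
      rw [realCoord_gridPoint, abs_mul, abs_of_pos hδ,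
        abs_of_nonneg (by exact_mod_cast hi.1)]
      gcongr
      exact_mod_cast hi.2.le
    have hsub : P ⊆ Finset.univ.biUnion fun i =>
        P.filter fun n => ‖gridPoint u₂ p₂ δ n - y i‖ ≤ ε := by
      intro n hn
      obtain ⟨i, hi⟩ := hP n hn
      exact Finset.mem_biUnion.2 ⟨i, Finset.mem_univ i, Finset.mem_filter.2 ⟨hn, hi⟩⟩
    have hle : (P.card : ℝ) ≤ 2 ^ (k - 1) * D ^ (2 * 2 ^ (j * d)) := by
      calc (P.card : ℝ) ≤ ∑ i, ((P.filter fun n => ‖gridPoint u₂ p₂ δ n - y i‖ ≤ ε).card : ℝ) := by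
            exact_mod_cast (Finset.card_le_card hsub).trans Finset.card_biUnion_le
        _ ≤ ∑ _i : Fin (2 ^ (k - 1)), D ^ (2 * 2 ^ (j * d)) :=
            Finset.sum_le_sum fun i _ => hgridV (y i) _ hpu₂ hε fun n hn =>
              (Finset.mem_filter.1 hn).2
        _ = _ := by simp
    have hlt : (2 : ℝ) ^ (k - 1) * D ^ (2 * 2 ^ (j * d)) < P.card := by
      calc (2 : ℝ) ^ (k - 1) * D ^ (2 * 2 ^ (j * d)) ≤ 2 ^ k * D ^ (2 * 2 ^ (j * d)) := by
            gcongr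
            · exact one_le_two
            · omega
        _ = (D * E) ^ (2 * 2 ^ (j * d)) := by
            rw [mul_pow, hEpow, mul_comm]
        _ < (L : ℝ) ^ (2 * 2 ^ (j * d)) := by
            exact pow_lt_pow_left₀ hL1 (by positivity) (by positivity)
        _ = P.card := by
            rw [hPcard]
            push_cast
            rfl
    exact absurd hle (not_le.2 hlt)
  have h1 : 1 ≤ V ^ (1 / u₁) * (2 * (δ * (2 * (D * E)))) := by
    refine key.le.trans ?_
    gcongr
  rw [hδdef, Real.rpow_neg hVpos.le] at h1
  rw [Real.rpow_neg hVpos.le]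
  have e : V ^ (1 / u₁) * (2 * (2 * 2 ^ (1 / p₂) * (ε * (V ^ (1 / u₂))⁻¹) * (2 * (D * E)))) =
      ε / (1 / (8 * D * 2 ^ (1 / p₂)) * (E⁻¹ * (V ^ (1 / u₂) * (V ^ (1 / u₁))⁻¹))) := by
    field_simp
    ring
  rwa [e, one_le_div (by positivity)] at h1

end Lower

end MorreySeq

end

theorem corollary5p5 (d : ℕ) (hd : 1 ≤ d) (u₁ p₁ u₂ p₂ : ℝ)
    (hp₁ : 0 < p₁) (hpu₁ : p₁ ≤ u₁) (hp₂ : 0 < p₂) (hpu₂ : p₂ ≤ u₂)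
    (c : ℝ) (hc : 0 < c) :
    ∃ A B : ℝ, 0 < A ∧ 0 < B ∧ ∀ j k : ℕ, c * (2 : ℝ) ^ (j * d) ≤ (k : ℝ) →
      A * ((2 : ℝ) ^ (-(k : ℝ) / (2 * (2 : ℝ) ^ (j * d))) *
          (2 : ℝ) ^ ((j : ℝ) * (d : ℝ) * (1 / u₂ - 1 / u₁))) ≤
        MorreySeq.entropyNumber k (MorreySeq.idMap d j u₁ p₁ u₂ p₂) ∧
      MorreySeq.entropyNumber k (MorreySeq.idMap d j u₁ p₁ u₂ p₂) ≤
        B * ((2 : ℝ) ^ (-(k : ℝ) / (2 * (2 : ℝ) ^ (j * d))) *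
          (2 : ℝ) ^ ((j : ℝ) * (d : ℝ) * (1 / u₂ - 1 / u₁))) := by
  obtain ⟨A, hA, hlower⟩ := MorreySeq.exists_le_of_cover hp₂
  obtain ⟨B, hB, hupper⟩ :=
    MorreySeq.exists_cover_unitBall d hp₁ hpu₁ hp₂ (hp₂.trans_le hpu₂) hc
  refine ⟨A, B, hA, hB, fun j k hk => ?_⟩
  have hk1 : 1 ≤ k := by
    have : (0 : ℝ) < k := lt_of_lt_of_le (by positivity) hk
    exact_mod_cast this
  obtain ⟨y, hy⟩ := hupper j k hk
  -- A real infimum over the empty set would be `0`; the covering from the upper bound shows that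
  -- the set of radii is nonempty.
  refine ⟨le_csInf ⟨_, by positivity, y, hy⟩ ?_,
    MorreySeq.entropyNumber_le (by positivity) y hy⟩
  rintro ε ⟨hε, z, hz⟩
  exact hlower d j k u₁ p₁ u₂ ε z hk1 hp₁ (hp₁.trans_le hpu₁) hpu₂ hε hz
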